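/- Let $\Gamma\le O(2)$ be a group of rotations about the origin (i.e. $\Gamma\le SO(2)$), finite or infinite, with $|\Gamma|\ge 3$, and let $G=(V,E)$ be a finite multigraph (loops and parallel edges allowed) that is $(2,1)$-tight: $|E|=2|V|-1$, and every nonempty $X\subseteq V$ induces at most $2|X|-1$ edges (loops included). Then there is a gain map $\phi:\vec E\to\Gamma$ such that the gain graph $(G,\phi)$ is $\Gamma$-symmetrically rigid in $\mathbb{R}^2$. Here $\vec E$ is the set of triples $(e,v,w)$ where $e\in E$ is an edge with ends $v,w$, regarded as having source $v$ and sink $w$. A gain map is a map $\phi:\vec E\to\Gamma$ such that $\phi(e,v,w)=\phi(e,w,v)^{-1}$ whenever $v\ne w$; $\phi(e,v,w)\neq\phi(e',v,w)$ for distinct edges $e,e'$ with the same ends $v,w$; and $\phi(e,v,v)\ne 1$ for every loop $e$. For a map $p:V\to\mathbb{R}^2$ (an orbit placement), the orbit rigidity matrix $R(G,\phi,p)$ is the $|E|\times 2|V|$ matrix whose row $e$ has, in the two columns of the vertex $v$, the vector $p(v)-\gamma p(w)$ if $e$ joins $v$ to some $w\ne v$ and $\gamma=\phi(e,v,w)$,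 the vector $2p(v)-\gamma p(v)-\gamma^{-1}p(v)$ if $e$ is a loop at $v$ and $\gamma=\phi(e,v,v)$, and $0$ otherwise. A map $u:V\to\mathbb{R}^2$ is a $\Gamma$-symmetric infinitesimal flex of $(G,\phi,p)$ if $R(G,\phi,p)u=0$; it is trivial if there are a skew-symmetric $2\times 2$ matrix $T$ and $x\in\mathbb{R}^2$ with $\gamma u(v)=T\gamma p(v)+x$ for all $v\in V$ and $\gamma\in\Gamma$. The gain graph $(G,\phi)$ is $\Gamma$-symmetrically rigid in $\mathbb{R}^2$ if there is an orbit placement $p$ for which every $\Gamma$-symmetric infinitesimal flex of $(G,\phi,p)$ is trivial. -/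

import Mathlib

open scoped Graph Matrix

/-! ### Counting sparsity of multigraphs -/

/-- `G` is `(k, l)`-sparse (for `l ≤ k`): every nonempty set `X` of vertices induces at most
`k * |X| - l` edges, loops included. Here `G` is understood to be finite. -/
def Graph.IsSparse {α β : Type*} (G : Graph α β) (k l : ℕ) : Prop :=
  ∀ X : Set α, X ⊆ V(G) → X.Nonempty → E(G.induce X).ncard + l ≤ k * X.ncard

/-- `G` is `(k, l)`-tight: it is `(k, l)`-sparse and has exactly `k * |V| - l` edges. -/
def Graph.IsTight {α β : Type*} (G : Graph α β) (k l : ℕ) : Prop :=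
  G.IsSparse k l ∧ E(G).ncard + l = k * V(G).ncard

/-! ### Gain graphs -/

/-- A gain map of the multigraph `G` with values in the group `Γ`: it assigns an element of `Γ` to
every triple `(e, v, w)` where `e` is an edge of `G` with source `v` and sink `w`. -/
structure Graph.GainMap {α β : Type*} (G : Graph α β) (Γ : Type*) [Group Γ] where
  /-- the gain of the oriented edge `(e, v, w)` -/
  gain : ∀ {e : β} {v w : α}, G.IsLink e v w → Γ
  /-- reversing a non-loop edge inverts its gain -/
  gain_symm : ∀ {e : β} {v w : α} (h : G.IsLink e v w), v ≠ w → gain h = (gain h.symm)⁻¹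
  /-- distinct parallel edges (and distinct loops at a vertex) have distinct gains -/
  gain_ne : ∀ {e e' : β} {v w : α} (h : G.IsLink e v w) (h' : G.IsLink e' v w),
    e ≠ e' → gain h ≠ gain h'
  /-- loops have non-trivial gains -/
  gain_loop : ∀ {e : β} {v : α} (h : G.IsLink e v v), gain h ≠ 1

/-! ### Orbit frameworks

`Γ` is a subgroup of `O(d)`, acting on `Fin d → ℝ` by `Matrix.mulVec`. An orbit placement of
a gain graph is a map `p : V(G) → Fin d → ℝ`. -/

/-- The matrix of an element of a subgroup of `O(d)`. -/
abbrev orthMat {d : ℕ} {Γ : Subgroup (Matrix.orthogonalGroup (Fin d) ℝ)} (γ : Γ) :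
    Matrix (Fin d) (Fin d) ℝ :=
  ((γ : Matrix.orthogonalGroup (Fin d) ℝ) : Matrix (Fin d) (Fin d) ℝ)

open Classical in
/-- The orbit rigidity matrix `R(G, φ, p)`: the entry in row `e` and column `(v, j)` is
* `[p(v) - γ p(w)]_j` if `e` joins `v` to `w ≠ v` and `φ(e, v, w) = γ`,
* `[2 p(v) - γ p(v) - γ⁻¹ p(v)]_j` if `e` is a loop at `v` and `φ(e, v, v) = γ`,
* `0` if `e` is not incident to `v`. -/
noncomputable def orbitRigidityMatrix {α β : Type*} {G : Graph α β} {d : ℕ}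
    {Γ : Subgroup (Matrix.orthogonalGroup (Fin d) ℝ)} (φ : G.GainMap Γ)
    (p : V(G) → Fin d → ℝ) : Matrix E(G) (V(G) × Fin d) ℝ :=
  fun e vj =>
    if h : ∃ w : V(G), G.IsLink e vj.1 w then
      if (vj.1 : V(G)) ≠ h.choose then
        (p vj.1 - orthMat (φ.gain h.choose_spec) *ᵥ p h.choose) vj.2
      else
        ((2 : ℝ) • p vj.1 - orthMat (φ.gain h.choose_spec) *ᵥ p vj.1
          - orthMat (φ.gain h.choose_spec)⁻¹ *ᵥ p vj.1) vj.2
    else 0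

open Classical in
/-- The other end of `e` is determined by `e` and `v`, so the choice above is harmless. -/
theorem orbitRigidityMatrix_of_ne {α β : Type*} {G : Graph α β} {d : ℕ}
    {Γ : Subgroup (Matrix.orthogonalGroup (Fin d) ℝ)} (φ : G.GainMap Γ)
    (p : V(G) → Fin d → ℝ) {e : E(G)} {v w : V(G)} (h : G.IsLink e v w) (hvw : v ≠ w)
    (j : Fin d) :
    orbitRigidityMatrix φ p e (v, j) = (p v - orthMat (φ.gain h) *ᵥ p w) j := by
  have hex : ∃ w : V(G), G.IsLink e v w := ⟨w, h⟩
  have hww : hex.choose = w := Subtype.ext (hex.choose_spec.right_unique h)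
  have key : ∀ (x : V(G)) (hx : G.IsLink e v x), x = w →
      (if v ≠ x then (p v - orthMat (φ.gain hx) *ᵥ p x) j
        else ((2 : ℝ) • p v - orthMat (φ.gain hx) *ᵥ p v
          - orthMat (φ.gain hx)⁻¹ *ᵥ p v) j)
      = (p v - orthMat (φ.gain h) *ᵥ p w) j := by
    rintro x hx rfl
    rw [if_pos hvw]
  unfold orbitRigidityMatrix
  rw [dif_pos hex]
  exact key _ hex.choose_spec hww

open Classical in
theorem orbitRigidityMatrix_of_loop {α β : Type*} {G : Graph α β} {d : ℕ}
    {Γ : Subgroup (Matrix.orthogonalGroup (Fin d) ℝ)} (φ : G.GainMap Γ)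
    (p : V(G) → Fin d → ℝ) {e : E(G)} {v : V(G)} (h : G.IsLink e v v) (j : Fin d) :
    orbitRigidityMatrix φ p e (v, j) =
      ((2 : ℝ) • p v - orthMat (φ.gain h) *ᵥ p v - orthMat (φ.gain h)⁻¹ *ᵥ p v) j := by
  have hex : ∃ w : V(G), G.IsLink e v w := ⟨v, h⟩
  have hww : hex.choose = v := Subtype.ext (hex.choose_spec.right_unique h)
  have key : ∀ (x : V(G)) (hx : G.IsLink e v x), x = v →
      (if v ≠ x then (p v - orthMat (φ.gain hx) *ᵥ p x) j
        else ((2 : ℝ) • p v - orthMat (φ.gain hx) *ᵥ p v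
          - orthMat (φ.gain hx)⁻¹ *ᵥ p v) j)
      = ((2 : ℝ) • p v - orthMat (φ.gain h) *ᵥ p v - orthMat (φ.gain h)⁻¹ *ᵥ p v) j := by
    rintro x hx rfl
    rw [if_neg (not_not.2 rfl)]
  unfold orbitRigidityMatrix
  rw [dif_pos hex]
  exact key _ hex.choose_spec hww

/-- `u` is a `Γ`-symmetric infinitesimal flex of the orbit framework `(G, φ, p)`: it lies in the
kernel of the orbit rigidity matrix. -/
def IsSymFlex {α β : Type*} {G : Graph α β} [Fintype V(G)] {d : ℕ}
    {Γ : Subgroup (Matrix.orthogonalGroup (Fin d) ℝ)} (φ : G.GainMap Γ)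
    (p u : V(G) → Fin d → ℝ) : Prop :=
  orbitRigidityMatrix φ p *ᵥ (fun vj : V(G) × Fin d => u vj.1 vj.2) = 0

/-- The `Γ`-symmetric extension of a map on `V(G)` to the vertex set `V(G) × Γ` of the covering
graph, `(v, γ) ↦ γ q(v)`. It turns orbit placements into placements and flexes into flexes. -/
def symLift {α β : Type*} {G : Graph α β} {d : ℕ}
    (Γ : Subgroup (Matrix.orthogonalGroup (Fin d) ℝ)) (q : V(G) → Fin d → ℝ) :
    V(G) × Γ → Fin d → ℝ :=
  fun x => orthMat x.2 *ᵥ q x.1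

/-- `u` is trivial for `p`: on the covering graph, the flex corresponding to `u` is the restriction
of an infinitesimal isometry `z ↦ T z + x` with `T` skew-symmetric. -/
def IsTrivialFlex {α β : Type*} {G : Graph α β} {d : ℕ}
    (Γ : Subgroup (Matrix.orthogonalGroup (Fin d) ℝ)) (p u : V(G) → Fin d → ℝ) : Prop :=
  ∃ (T : Matrix (Fin d) (Fin d) ℝ) (x : Fin d → ℝ), Tᵀ = -T ∧
    ∀ y : V(G) × Γ, symLift Γ u y = T *ᵥ symLift Γ p y + x

/-- The orbit framework `(G, φ, p)` is `Γ`-symmetrically (infinitesimally) rigid. -/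
def IsSymRigidOrbitFramework {α β : Type*} {G : Graph α β} [Fintype V(G)] {d : ℕ}
    {Γ : Subgroup (Matrix.orthogonalGroup (Fin d) ℝ)} (φ : G.GainMap Γ)
    (p : V(G) → Fin d → ℝ) : Prop :=
  ∀ u : V(G) → Fin d → ℝ, IsSymFlex φ p u → IsTrivialFlex Γ p u

/-- The gain graph `(G, φ)` is `Γ`-symmetrically rigid in `ℝ^d`: some orbit placement of it is
`Γ`-symmetrically rigid. -/
def IsSymRigid {α β : Type*} {G : Graph α β} [Fintype V(G)] {d : ℕ}
    {Γ : Subgroup (Matrix.orthogonalGroup (Fin d) ℝ)} (φ : G.GainMap Γ) : Prop :=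
  ∃ p : V(G) → Fin d → ℝ, IsSymRigidOrbitFramework φ p

/-! Identify the plane with `ℂ` and a rotation with its unit number `ρ`. An edge then requires
`u(hd) - ρ u(tl)` to be perpendicular to `p(hd) - ρ p(tl)`. Instead of `p`, choose a generic normal
direction `d e` for each edge: the conditions `Re (conj (d e) (u(hd) - ρ u(tl))) = 0` are `2|V| - 1`
real linear equations in `2|V|` unknowns, so they have a nonzero solution `p`. If doubling any edge
`e₀`, with a fresh direction, makes the system nonsingular, then `p` is unique up to a real scalar
and no `p(hd) - ρ p(tl)` vanishes. For a flex `u`, `I * u` solves the same equations, so it is a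
real multiple of `p` and `u` is an infinitesimal rotation (`exists_rigid_placement`).

Nonsingularity is tested at isotropic complex directions, where the system splits into two
`|V|`-square systems. It suffices that the edges plus a copy of `e₀` split into two bases of the
frame matroid. Sparsity and Hall's theorem give a spanning tree and one further edge `π v` into each
`v`. The tree gets gain 1; the edges `π v` get two distinct nontrivial gains (hence `|Γ| ≥ 3`) that
make them a basis. Basis exchange does the rest (`exists_two_bases`). -/

/-! ### Nonvanishing of polynomials and weighted Laplacians -/

/-- The product of the polynomials is nonzero, and the real points are Zariski dense. Nonsingularity
checked at complex directions thus passes to one real choice serving all edges. -/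
theorem exists_real_eval_ne_zero {ι κ : Type*} [Fintype κ] (F : κ → MvPolynomial ι ℂ)
    (hF : ∀ k, ∃ x : ι → ℂ, MvPolynomial.eval x (F k) ≠ 0) :
    ∃ x : ι → ℝ, ∀ k, MvPolynomial.eval (fun i => (x i : ℂ)) (F k) ≠ 0 := by
  by_contra! h
  have h0 : ∏ k, F k = 0 := by
    refine MvPolynomial.funext_set (fun _ => Set.range ((↑) : ℝ → ℂ))
      (fun _ => Set.infinite_range_of_injective Complex.ofReal_injective) fun x hx => ?_
    have hx' : ∀ i, ∃ y : ℝ, (y : ℂ) = x i := fun i => hx i (Set.mem_univ i)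
    choose y hy using hx'
    obtain ⟨k, hk⟩ := h y
    rw [map_prod, map_zero]
    refine Finset.prod_eq_zero (Finset.mem_univ k) ?_
    rw [← hk]
    congr 2
    exact funext fun i => (hy i).symm
  obtain ⟨k, -, hk⟩ := Finset.prod_eq_zero_iff.1 h0
  obtain ⟨x, hx⟩ := hF k
  exact hx (by rw [hk, map_zero])

/-- A functional digraph can be given weights from any two distinct values so that its weighted
Laplacian is nonsingular. -/
theorem exists_weights_det_ne_zero {V Γ : Type*} [Fintype V] [DecidableEq V] (f : V → V)
    (ρ : Γ → ℂ) {g g' : Γ} (hg : ρ g ≠ ρ g') :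
    ∃ c : V → Γ, (∀ v, c v = g ∨ c v = g') ∧
      (Matrix.of fun v => (Pi.single v 1 - ρ (c v) • Pi.single (f v) 1 : V → ℂ)).det ≠ 0 := by
  -- Rows outside `S` are rows of the identity; the induction turns on one row at a time.
  suffices H : ∀ S : Finset V, ∃ c : V → Γ, (∀ v, c v = g ∨ c v = g') ∧
      (Matrix.of fun v => if v ∈ S then (Pi.single v 1 - ρ (c v) • Pi.single (f v) 1 : V → ℂ)
        else Pi.single v 1).det ≠ 0 by
    simpa using H Finset.univ
  intro S
  induction S using Finset.induction_on with
  | empty =>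
    refine ⟨fun _ => g, fun _ => Or.inl rfl, ?_⟩
    have : (Matrix.of fun v => (Pi.single v 1 : V → ℂ)) = 1 := by
      ext i j
      simp [Matrix.one_apply, Pi.single_apply, eq_comm]
    simp [this]
  | insert a S ha ih =>
    obtain ⟨c, hc, hdet⟩ := ih
    set M := Matrix.of fun v => if v ∈ S then
      (Pi.single v 1 - ρ (c v) • Pi.single (f v) 1 : V → ℂ) else Pi.single v 1 with hM
    have key : ∀ t : Γ, (Matrix.of fun v => if v ∈ insert a S then
        (Pi.single v 1 - ρ (Function.update c a t v) • Pi.single (f v) 1 : V → ℂ)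
        else Pi.single v 1).det
        = M.det + -ρ t * (M.updateRow a (Pi.single (f a) 1)).det := by
      intro t
      rw [← Matrix.det_updateRow_smul]
      have h1 : M.det = (M.updateRow a (Pi.single a 1)).det := by
        congr 1
        ext i j
        by_cases hi : i = a
        · subst hi; simp [hM, ha]
        · simp [Matrix.updateRow_ne hi]
      rw [h1, ← Matrix.det_updateRow_add]
      congr 1
      ext i j
      by_cases hi : i = a
      · subst hi; simp [sub_eq_add_neg]
      · simp [hM, hi]
    -- The determinant is affine in the new weight, with constant term `M.det ≠ 0`, so it cannot
    -- vanish at two distinct values.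
    have : ∃ t, (t = g ∨ t = g') ∧ M.det + -ρ t * (M.updateRow a (Pi.single (f a) 1)).det ≠ 0 := by
      by_contra! h
      have h1 := h g (Or.inl rfl)
      have h2 := h g' (Or.inr rfl)
      have h3 : (ρ g - ρ g') * (M.updateRow a (Pi.single (f a) 1)).det = 0 := by
        linear_combination h2 - h1
      rcases mul_eq_zero.1 h3 with h4 | h4
      · exact hg (sub_eq_zero.1 h4)
      · rw [h4, mul_zero, add_zero] at h1
        exact hdet h1
    obtain ⟨t, ht, htd⟩ := this
    refine ⟨Function.update c a t, fun v => ?_, ?_⟩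
    · by_cases hv : v = a
      · subst hv; simpa using ht
      · simpa [hv] using hc v
    · rw [key]; exact htd

/-! ### Reachability in a digraph -/

/-- The rank is the distance from `r`; the hypothesis, applied to the set of vertices at infinite
distance, shows that it is empty. -/
theorem exists_rank_of_reachable {V E : Type*} (hd tl : E → V) (r : V)
    (h : ∀ X : Set V, X.Nonempty → r ∉ X → ∃ e, hd e ∈ X ∧ tl e ∉ X) :
    ∃ rank : V → ℕ, ∀ v, v ≠ r → ∃ e, hd e = v ∧ rank (tl e) < rank v := by
  classical
  let S : ℕ → Set V := fun k => Nat.rec (motive := fun _ => Set V) {r}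
    (fun _ s => s ∪ {v | ∃ e, hd e = v ∧ tl e ∈ s}) k
  have hS : ∀ k, S (k + 1) = S k ∪ {v | ∃ e, hd e = v ∧ tl e ∈ S k} := fun k => rfl
  have hall : ∀ v, ∃ k, v ∈ S k := by
    by_contra! hne
    obtain ⟨v, hv⟩ := hne
    obtain ⟨e, he, he'⟩ := h {v | ∀ k, v ∉ S k} ⟨v, hv⟩ fun hr => hr 0 rfl
    simp only [Set.mem_ofPred_eq, not_forall, not_not] at he he'
    obtain ⟨k, hk⟩ := he'
    exact he (k + 1) (by rw [hS]; exact Or.inr ⟨e, rfl, hk⟩)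
  refine ⟨fun v => Nat.find (hall v), fun v hv => ?_⟩
  beta_reduce
  have hm : v ∈ S (Nat.find (hall v)) := Nat.find_spec (hall v)
  have hmin : ∀ m < Nat.find (hall v), v ∉ S m := fun m hm => Nat.find_min (hall v) hm
  obtain hz | ⟨k, hk⟩ : Nat.find (hall v) = 0 ∨ ∃ k, Nat.find (hall v) = k + 1 := by
    cases Nat.find (hall v) <;> simp
  · rw [hz] at hm
    exact absurd hm hv
  · rw [hk, hS] at hm
    rcases hm with hm | ⟨e, he, hte⟩
    · exact absurd hm (hmin k (by omega))
    · refine ⟨e, he, ?_⟩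
      have := Nat.find_min' (hall (tl e)) hte
      omega

/-! ### From frame matroid bases to a rigid placement -/

/-- The rigidity argument: `hd`, `tl` are the ends of the edges, `ρ` their gains. If, for every
edge `e₀`, the edges together with a second copy of `e₀` split into two bases of the frame matroid,
then some placement has only trivial flexes. -/
theorem exists_rigid_placement {V E : Type*} [Fintype V] [Fintype E] [Nonempty E]
    (hcard : Fintype.card E + 1 = 2 * Fintype.card V) (hd tl : E → V) (ρ : E → ℂ)
    (hρ : ∀ e₀, ∃ S : Set E,
      (∀ z : V → ℂ, (∀ e ∈ S, z (hd e) = ρ e * z (tl e)) → z = 0) ∧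
      (∀ z : V → ℂ, (∀ e ∉ S, z (hd e) = ρ e * z (tl e)) →
        z (hd e₀) = ρ e₀ * z (tl e₀) → z = 0)) :
    ∃ p : V → ℂ, ∀ u : V → ℂ,
      (∀ e, ((starRingEnd ℂ) (p (hd e) - ρ e * p (tl e)) * (u (hd e) - ρ e * u (tl e))).re = 0) →
      ∃ c : ℝ, ∀ v, u v = c * Complex.I * p v := by
  classical
  -- In `Option E`, `none` is the second copy of `e₀`, which makes the system square.
  have hc : Fintype.card (V ⊕ V) = Fintype.card (Option E) := by
    simp; omega
  let σ : V ⊕ V ≃ Option E := Fintype.equivOfCardEq hc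
  let X : Option E → Fin 2 → MvPolynomial (Option E × Fin 2) ℂ := fun o j => MvPolynomial.X (o, j)
  let C : ℂ →+* MvPolynomial (Option E × Fin 2) ℂ := MvPolynomial.C
  -- Twice the real part, with `u` and its conjugate replaced by independent unknowns `z` and `z'`.
  let M : E → Matrix (V ⊕ V) (V ⊕ V) (MvPolynomial (Option E × Fin 2) ℂ) := fun e₀ =>
    Matrix.of fun i => Sum.elim
      (fun v => (X (σ i) 0 - C Complex.I * X (σ i) 1) *
        C ((if v = hd ((σ i).getD e₀) then 1 else 0) -
          (if v = tl ((σ i).getD e₀) then ρ ((σ i).getD e₀) else 0)))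
      (fun v => (X (σ i) 0 + C Complex.I * X (σ i) 1) *
        C ((if v = hd ((σ i).getD e₀) then 1 else 0) -
          (if v = tl ((σ i).getD e₀) then (starRingEnd ℂ) (ρ ((σ i).getD e₀)) else 0)))
  have hker : ∀ (e₀ : E) (x : Option E × Fin 2 → ℂ), MvPolynomial.eval x (M e₀).det ≠ 0 ↔
      ∀ z z' : V → ℂ, (∀ o : Option E,
        (x (o, 0) - Complex.I * x (o, 1)) *
          (z (hd (o.getD e₀)) - ρ (o.getD e₀) * z (tl (o.getD e₀))) +
        (x (o, 0) + Complex.I * x (o, 1)) *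
          (z' (hd (o.getD e₀)) - (starRingEnd ℂ) (ρ (o.getD e₀)) * z' (tl (o.getD e₀))) = 0) →
        z = 0 ∧ z' = 0 := by
    intro e₀ x
    have hmul : ∀ (w : V ⊕ V → ℂ) (i : V ⊕ V),
        ((MvPolynomial.eval x).mapMatrix (M e₀) *ᵥ w) i =
        (x (σ i, 0) - Complex.I * x (σ i, 1)) *
          (w (.inl (hd ((σ i).getD e₀))) - ρ ((σ i).getD e₀) * w (.inl (tl ((σ i).getD e₀)))) +
        (x (σ i, 0) + Complex.I * x (σ i, 1)) *
          (w (.inr (hd ((σ i).getD e₀))) -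
            (starRingEnd ℂ) (ρ ((σ i).getD e₀)) * w (.inr (tl ((σ i).getD e₀)))) := by
      intro w i
      simp [Matrix.mulVec, dotProduct, M, X, C, mul_assoc, ← Finset.mul_sum, sub_mul,
        Finset.sum_sub_distrib, -mul_eq_mul_left_iff]
    rw [RingHom.map_det, ne_eq, ← Matrix.exists_mulVec_eq_zero_iff]
    push Not
    constructor
    · intro h z z' hz
      by_contra hne
      refine h (Sum.elim z z') (fun h0 => hne ⟨?_, ?_⟩) (funext fun i => ?_)
      · exact funext fun v => congrFun h0 (.inl v)
      · exact funext fun v => congrFun h0 (.inr v)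
      · rw [hmul]; exact hz (σ i)
    · intro h w hw h0
      refine hw ?_
      obtain ⟨h1, h2⟩ := h (fun v => w (.inl v)) (fun v => w (.inr v)) fun o => by
        have := congrFun h0 (σ.symm o)
        rw [hmul] at this
        simpa using this
      funext i
      rcases i with v | v
      · exact congrFun h1 v
      · exact congrFun h2 v
  obtain ⟨x, hx⟩ := exists_real_eval_ne_zero (fun e₀ => (M e₀).det) fun e₀ => by
    obtain ⟨S, hS, hS'⟩ := hρ e₀
    let inS : Option E → Prop := fun o => ∃ e ∈ S, o = some e
    -- Isotropic directions: `(1, I)` kills the coefficient of `z'` and `(1, -I)` that of `z`. Edges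
    -- of `S` constrain only `z`; the others and the copy of `e₀` only `z'`.
    refine ⟨fun a => if a.2 = 0 then 1 else if inS a.1 then Complex.I else -Complex.I, ?_⟩
    rw [hker]
    intro z z' h
    have hpos : ∀ e ∈ S, z (hd e) = ρ e * z (tl e) := fun e he => by
      have h1 := h (some e)
      have h2 : inS (some e) := ⟨e, he, rfl⟩
      simp [h2] at h1
      linear_combination h1
    have hneg : ∀ o : Option E, ¬ inS o → z' (hd (o.getD e₀)) =
        (starRingEnd ℂ) (ρ (o.getD e₀)) * z' (tl (o.getD e₀)) := fun o ho => by
      have h1 := h o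
      simp [ho] at h1
      linear_combination h1
    refine ⟨hS z hpos, ?_⟩
    have := hS' (fun v => (starRingEnd ℂ) (z' v))
      (fun e he => by
        have := hneg (some e) (by rintro ⟨e', he', h⟩; cases h; exact he he')
        simp only [Option.getD_some] at this
        rw [this]; simp)
      (by
        have := hneg none (by rintro ⟨e', he', h⟩; cases h)
        simp only [Option.getD_none] at this
        rw [this]; simp)
    funext v
    simpa using congrFun this v
  let d : Option E → ℂ := fun o => ⟨x (o, 0), x (o, 1)⟩
  let N : Option E → E → (V → ℂ) → ℝ := fun o e u =>
    ((starRingEnd ℂ) (d o) * (u (hd e) - ρ e * u (tl e))).re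
  have hN : ∀ e₀ (u : V → ℂ), (∀ o : Option E, N o (o.getD e₀) u = 0) → u = 0 := by
    intro e₀ u hu
    refine ((hker e₀ _).1 (hx e₀) u (fun v => (starRingEnd ℂ) (u v)) fun o => ?_).1
    have h1 := hu o
    have h2 : (x (o, 0) : ℂ) + Complex.I * x (o, 1) = d o := by
      apply Complex.ext <;> simp [d]
    have h3 : (x (o, 0) : ℂ) - Complex.I * x (o, 1) = (starRingEnd ℂ) (d o) := by
      apply Complex.ext <;> simp [d]
    rw [h2, h3]
    have h4 := Complex.add_conj ((starRingEnd ℂ) (d o) *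
      (u (hd (o.getD e₀)) - ρ (o.getD e₀) * u (tl (o.getD e₀))))
    simp only [N] at h1
    rw [h1] at h4
    simpa using h4
  let Nlin : (V → ℂ) →ₗ[ℝ] (E → ℝ) :=
    { toFun := fun u e => N (some e) e u
      map_add' := fun u w => by
        funext e; simp [N]; ring
      map_smul' := fun c u => by
        funext e; simp [N]; ring }
  have hlt : Module.finrank ℝ (E → ℝ) < Module.finrank ℝ (V → ℂ) := by
    rw [Module.finrank_pi, Module.finrank_pi_fintype]
    simp
    omega
  obtain ⟨p, hp, hp0⟩ := (Submodule.ne_bot_iff _).1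
    (LinearMap.ker_ne_bot_of_finrank_lt (f := Nlin) hlt)
  have hp' : ∀ e, N (some e) e p = 0 := fun e => congrFun hp e
  have hnone : ∀ e, N none e p ≠ 0 := fun e h => hp0 <| hN e p fun o => by
    cases o with
    | none => exact h
    | some e' => exact hp' e'
  refine ⟨p, fun u hu => ?_⟩
  -- With `a`, `b` the edge differences of `p`, `u`: both `d` and `b` are perpendicular to `a ≠ 0`,
  -- so `I * b` is perpendicular to `d`.
  have hw : ∀ e, N (some e) e (fun v => Complex.I * u v) = 0 := by
    intro e
    have h1 := hp' e
    have h2 := hu e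
    have h3 : p (hd e) - ρ e * p (tl e) ≠ 0 := fun h =>
      hnone e (by simp only [N, h, mul_zero, Complex.zero_re])
    have h4 : Complex.I * u (hd e) - ρ e * (Complex.I * u (tl e)) =
        Complex.I * (u (hd e) - ρ e * u (tl e)) := by ring
    simp only [N] at h1 ⊢
    rw [h4]
    generalize p (hd e) - ρ e * p (tl e) = a at *
    generalize u (hd e) - ρ e * u (tl e) = b at *
    generalize d (some e) = d at *
    have h5 : a.re * a.re + a.im * a.im ≠ 0 := by
      rw [← Complex.normSq_apply]; exact fun h => h3 (Complex.normSq_eq_zero.1 h)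
    simp at h1 h2 ⊢
    refine (mul_eq_zero.1 (?_ : (a.re * a.re + a.im * a.im) * _ = 0)).resolve_left h5
    linear_combination (a.im * b.re - a.re * b.im) * h1
      + (d.im * a.re - d.re * a.im) * h2
  obtain ⟨e₀⟩ := ‹Nonempty E›
  -- Chosen so that `I * u - c * p` also satisfies the equation of the doubled edge.
  set c : ℝ := N none e₀ (fun v => Complex.I * u v) / N none e₀ p with hcdef
  have hz := hN e₀ (fun v => Complex.I * u v - c * p v) fun o => by
    have hlin : ∀ o e, N o e (fun v => Complex.I * u v - c * p v) =
        N o e (fun v => Complex.I * u v) - c * N o e p := by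
      intro o e
      simp [N]; ring
    rw [hlin]
    cases o with
    | none =>
      simp only [Option.getD_none]
      rw [hcdef, div_mul_cancel₀ _ (hnone e₀), sub_self]
    | some e =>
      simp only [Option.getD_some]
      rw [hw, hp', mul_zero, sub_zero]
  refine ⟨-c, fun v => ?_⟩
  have h1 : Complex.I * u v - c * p v = 0 := congrFun hz v
  push_cast
  linear_combination -Complex.I * h1 + u v * Complex.I_mul_I

/-! ### Orienting a tight multigraph -/

/-- A `(2, 1)`-tight multigraph can be oriented so that its edges split into a spanning tree, along
which `rank` decreases, and a set of edges `π v`, exactly one for each head `v`. -/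
theorem Graph.IsTight.exists_orientation {α β : Type*} {G : Graph α β} [Fintype V(G)]
    [Finite E(G)] (hG : G.IsTight 2 1) :
    ∃ (hd tl : E(G) → V(G)) (π : V(G) → E(G)) (rank : V(G) → ℕ) (r : V(G)),
      (∀ e : E(G), G.IsLink e (hd e) (tl e)) ∧ (∀ v, hd (π v) = v) ∧
      (∀ e, e ≠ π (hd e) → rank (tl e) < rank (hd e)) ∧
      (∀ v, v ≠ r → ∃ e, hd e = v ∧ e ≠ π (hd e)) ∧
      (∀ e e', e ≠ π (hd e) → e' ≠ π (hd e') → hd e = hd e' → e = e') := by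
  classical
  have := Fintype.ofFinite E(G)
  obtain ⟨hs, hE⟩ := hG
  have hEcard : Fintype.card E(G) + 1 = 2 * Fintype.card V(G) := by
    rw [← Nat.card_eq_fintype_card, ← Nat.card_eq_fintype_card]
    exact hE
  have hsp : ∀ (X : Finset V(G)) (s : Finset E(G)), X.Nonempty →
      (∀ e ∈ s, ∀ x y : V(G), G.IsLink e x y → x ∈ X ∧ y ∈ X) → s.card + 1 ≤ 2 * X.card := by
    intro X s hX hsX
    have h1 := hs (Subtype.val '' (X : Set V(G))) (by rintro _ ⟨x, -, rfl⟩; exact x.2)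
      (by simpa using hX)
    rw [Set.ncard_image_of_injective _ Subtype.val_injective, Set.ncard_coe_finset] at h1
    have h2 : (Subtype.val '' (s : Set E(G))).ncard ≤
        E(G.induce (Subtype.val '' (X : Set V(G)))).ncard := by
      refine Set.ncard_le_ncard ?_ ?_
      · rintro _ ⟨e, he, rfl⟩
        obtain ⟨x, y, hxy⟩ := G.exists_isLink_of_mem_edgeSet e.2
        obtain ⟨hx, hy⟩ := hsX e he ⟨x, hxy.left_mem⟩ ⟨y, hxy.right_mem⟩ hxy
        exact ⟨x, y, hxy, ⟨_, hx, rfl⟩, ⟨_, hy, rfl⟩⟩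
      · refine (Set.toFinite E(G)).subset ?_
        rintro e ⟨x, y, hxy, -⟩
        exact hxy.edge_mem
    rw [Set.ncard_image_of_injective _ Subtype.val_injective, Set.ncard_coe_finset] at h2
    omega
  have : Nonempty V(G) := Fintype.card_pos_iff.1 (by omega)
  obtain ⟨r⟩ := this
  -- Each vertex offers two slots, except `r`, which offers one; an edge is to be headed at the
  -- vertex whose slot it takes. Sparsity is Hall's condition, and tightness makes the matching fill
  -- every slot.
  let t : E(G) → Finset (V(G) × Bool) := fun e =>
    {x | (∃ y : V(G), G.IsLink e x.1 y) ∧ x ≠ (r, true)}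
  obtain ⟨f, hf, hft⟩ := (Finset.all_card_le_biUnion_card_iff_exists_injective t).1 fun s => by
    rcases s.eq_empty_or_nonempty with rfl | ⟨e, he⟩
    · simp
    let X : Finset V(G) := {x | ∃ e ∈ s, ∃ y : V(G), G.IsLink e x y}
    have hmem : ∀ e ∈ s, ∀ x y : V(G), G.IsLink e x y → x ∈ X := fun e he x y hxy =>
      Finset.mem_filter.2 ⟨Finset.mem_univ x, e, he, y, hxy⟩
    have h1 := hsp X s (by
      obtain ⟨x, y, hxy⟩ := G.exists_isLink_of_mem_edgeSet e.2
      exact ⟨⟨x, hxy.left_mem⟩, hmem e he _ ⟨y, hxy.right_mem⟩ hxy⟩)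
      (fun e he x y hxy => ⟨hmem e he x y hxy, hmem e he y x hxy.symm⟩)
    have h2 : (X ×ˢ (Finset.univ : Finset Bool)).erase (r, true) ⊆ s.biUnion t := by
      intro x hx
      simp only [Finset.mem_erase, Finset.mem_product, Finset.mem_univ, and_true, X,
        Finset.mem_filter, true_and] at hx
      obtain ⟨hxr, e, he, y, hxy⟩ := hx
      simp only [Finset.mem_biUnion, t, Finset.mem_filter, Finset.mem_univ, true_and]
      exact ⟨e, he, ⟨y, hxy⟩, hxr⟩
    have h3 := Finset.card_le_card h2
    have h4 := Finset.pred_card_le_card_erase (s := X ×ˢ (Finset.univ : Finset Bool))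
      (a := (r, true))
    rw [Finset.card_product, Finset.card_univ, Fintype.card_bool] at h4
    omega
  have hft' : ∀ e : E(G), (∃ y : V(G), G.IsLink e (f e).1 y) ∧ f e ≠ (r, true) := fun e => by
    simpa only [t, Finset.mem_filter, Finset.mem_univ, true_and] using hft e
  have hfs : ∀ x, x ≠ (r, true) → ∃ e, f e = x := by
    have h1 : Finset.univ.image f = Finset.univ.erase (r, true) := by
      refine Finset.eq_of_subset_of_card_le ?_ ?_
      · intro x hx
        obtain ⟨e, -, rfl⟩ := Finset.mem_image.1 hx
        exact Finset.mem_erase.2 ⟨(hft' e).2, Finset.mem_univ _⟩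
      · rw [Finset.card_image_of_injective _ hf, Finset.card_erase_of_mem (Finset.mem_univ _),
          Finset.card_univ, Finset.card_univ, Fintype.card_prod, Fintype.card_bool]
        omega
    intro x hx
    have : x ∈ Finset.univ.image f := h1 ▸ Finset.mem_erase.2 ⟨hx, Finset.mem_univ _⟩
    simpa using this
  choose tl htl using fun e : E(G) => (hft' e).1
  -- If every edge headed in `X` also had its tail in `X`, then `X`, avoiding `r`, would induce
  -- `2|X|` edges, one more than sparsity allows.
  obtain ⟨rank, hrank⟩ := exists_rank_of_reachable (fun e => (f e).1) tl r fun X hX hr => by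
    by_contra! hcl
    let X' : Finset V(G) := X.toFinset
    have hX' : X'.Nonempty := by simpa [X'] using hX
    have h1 := hsp X' (Finset.univ.filter fun e => (f e).1 ∈ X') hX' (by
      intro e he x y hxy
      simp only [Finset.mem_filter, Finset.mem_univ, true_and, X', Set.mem_toFinset] at he ⊢
      rcases hxy.eq_and_eq_or_eq_and_eq (htl e) with ⟨h1, h2⟩ | ⟨h1, h2⟩
      · rw [Subtype.ext h1, Subtype.ext h2]; exact ⟨he, hcl e he⟩
      · rw [Subtype.ext h1, Subtype.ext h2]; exact ⟨hcl e he, he⟩)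
    have h2 : (X' ×ˢ (Finset.univ : Finset Bool)) ⊆
        (Finset.univ.filter fun e => (f e).1 ∈ X').image f := by
      rintro x hx
      have hx1 : x.1 ∈ X' := (Finset.mem_product.1 hx).1
      obtain ⟨e, rfl⟩ := hfs x (by rintro rfl; exact hr (by simpa [X'] using hx1))
      exact Finset.mem_image_of_mem f (by simpa using hx1)
    have h3 := Finset.card_le_card h2
    rw [Finset.card_image_of_injective _ hf, Finset.card_product, Finset.card_univ,
      Fintype.card_bool] at h3
    omega
  have hpair : ∀ v, ∃ e : E(G), (f e).1 = v ∧
      (∀ e', (f e').1 = v → e' ≠ e → rank (tl e') < rank v) ∧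
      (v ≠ r → ∃ e', (f e').1 = v ∧ e' ≠ e) ∧
      (∀ e' e'', (f e').1 = v → (f e'').1 = v → e' ≠ e → e'' ≠ e → e' = e'') := by
    intro v
    by_cases hv : v = r
    · subst hv
      obtain ⟨e, he⟩ := hfs (v, false) (by simp)
      have huniq : ∀ e', (f e').1 = v → e' = e := fun e' he' => by
        apply hf
        rw [he]
        refine Prod.ext he' ?_
        by_contra hb
        exact (hft' e').2 (Prod.ext he' (by simpa using hb))
      exact ⟨e, by rw [he], fun e' h h' => absurd (huniq e' h) h', fun h => absurd rfl h,
        fun e' e'' h _ h' => absurd (huniq e' h) h'⟩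
    · obtain ⟨e₁, h₁, hr₁⟩ := hrank v hv
      -- The rank-decreasing edge `e₁` goes to the tree, and the edge in the other slot becomes `π
      -- v`. At `r` the only slot gives `π r`.
      obtain ⟨e₂, h₂⟩ := hfs (v, !(f e₁).2) (by simp [hv])
      have hne : e₁ ≠ e₂ := by
        rintro rfl
        have := congrArg Prod.snd h₂
        simp at this
      have huniq : ∀ e', (f e').1 = v → e' ≠ e₂ → e' = e₁ := fun e' he' hne' => by
        apply hf
        refine Prod.ext (he'.trans h₁.symm) ?_
        by_contra hb
        refine hne' (hf ?_)
        rw [h₂]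
        refine Prod.ext he' ?_
        cases h3 : (f e').2 <;> cases h4 : (f e₁).2 <;> simp_all
      refine ⟨e₂, by rw [h₂], fun e' h h' => ?_, fun _ => ⟨e₁, h₁, hne⟩,
        fun e' e'' h h' k k' => (huniq e' h k).trans (huniq e'' h' k').symm⟩
      rw [huniq e' h h']
      exact hr₁
  choose π h1 h2 h3 h4 using hpair
  refine ⟨fun e => (f e).1, tl, π, rank, r, htl, h1, fun e he => h2 _ e rfl he, fun v hv => ?_,
    fun e e' he he' h => h4 _ e e' rfl h.symm he (by simpa only [h] using he')⟩
  obtain ⟨e, he, hne⟩ := h3 v hv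
  exact ⟨e, he, by simpa only [he] using hne⟩

/-! ### Basis exchange -/

/-- With trivial weights on a spanning tree and nontrivial weights, of nonsingular weighted
Laplacian, on the other edges `π v`, doubling any edge gives a union of two bases. -/
theorem exists_two_bases {V E : Type*} [Fintype V] [DecidableEq V] (hd tl : E → V) (π : V → E)
    (rank : V → ℕ) (r : V) (hπ : ∀ v, hd (π v) = v)
    (hrank : ∀ e, e ≠ π (hd e) → rank (tl e) < rank (hd e))
    (htree : ∀ v, v ≠ r → ∃ e, hd e = v ∧ e ≠ π (hd e)) (ρ : E → ℂ)
    (hρtree : ∀ e, e ≠ π (hd e) → ρ e = 1) (hρπ : ∀ v, ρ (π v) ≠ 1)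
    (hdet : (Matrix.of fun v =>
      (Pi.single v 1 - ρ (π v) • Pi.single (tl (π v)) 1 : V → ℂ)).det ≠ 0) (e₀ : E) :
    ∃ S : Set E,
      (∀ z : V → ℂ, (∀ e ∈ S, z (hd e) = ρ e * z (tl e)) → z = 0) ∧
      (∀ z : V → ℂ, (∀ e ∉ S, z (hd e) = ρ e * z (tl e)) →
        z (hd e₀) = ρ e₀ * z (tl e₀) → z = 0) := by
  set M := Matrix.of fun v => (Pi.single v 1 - ρ (π v) • Pi.single (tl (π v)) 1 : V → ℂ) with hM
  have hMz : ∀ (z : V → ℂ) v, (M *ᵥ z) v = z v - ρ (π v) * z (tl (π v)) := by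
    intro z v
    change (Pi.single v 1 - ρ (π v) • Pi.single (tl (π v)) 1 : V → ℂ) ⬝ᵥ z = _
    simp [sub_dotProduct]
  have hinj : ∀ z : V → ℂ, M *ᵥ z = 0 → z = 0 := fun z hz =>
    Matrix.eq_zero_of_mulVec_eq_zero hdet hz
  let row : V → ℂ := Pi.single (hd e₀) 1 - ρ e₀ • Pi.single (tl e₀) 1
  have hrow : ∀ z : V → ℂ, row ⬝ᵥ z = z (hd e₀) - ρ e₀ * z (tl e₀) := by
    intro z
    simp [row, sub_dotProduct]
  -- The coordinates of the row of `e₀` in the basis formed by the rows of the edges `π v`.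
  let c : V → ℂ := row ᵥ* M⁻¹
  have hc : c ᵥ* M = row := by
    rw [Matrix.vecMul_vecMul, Matrix.nonsing_inv_mul _ (isUnit_iff_ne_zero.2 hdet),
      Matrix.vecMul_one]
  have hc' : ∀ z : V → ℂ, z (hd e₀) - ρ e₀ * z (tl e₀) =
      ∑ v, c v * (z v - ρ (π v) * z (tl (π v))) := by
    intro z
    rw [← hrow, ← hc, ← Matrix.dotProduct_mulVec]
    simp only [dotProduct, hMz]
  -- The row of `e₀` is nonzero: a loop cannot decrease the rank, so it is some `π v` and has weight
  -- different from 1.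
  have hne : ∃ v, c v ≠ 0 := by
    by_contra! h
    have h0 := hc' (Pi.single (hd e₀) 1)
    simp only [h, zero_mul, Finset.sum_const_zero, Pi.single_eq_same] at h0
    by_cases ht : tl e₀ = hd e₀
    · rw [ht, Pi.single_eq_same, mul_one] at h0
      by_cases he : e₀ = π (hd e₀)
      · exact hρπ (hd e₀) (by rw [← he]; linear_combination -h0)
      · have := hrank e₀ he
        rw [ht] at this
        exact lt_irrefl _ this
    · rw [Pi.single_eq_of_ne ht] at h0
      simp at h0
  obtain ⟨f, hf⟩ := hne
  -- The tree forces `z` to be constant, and the nontrivial weight of `π f` makes it zero. In the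
  -- complement, `e₀` replaces `π f`, as `c f ≠ 0` permits.
  refine ⟨{e | e ≠ π (hd e) ∨ e = π f}, fun z hz => ?_, fun z hz hz₀ => ?_⟩
  · have hconst : ∀ n v, rank v = n → z v = z r := by
      intro n
      induction n using Nat.strong_induction_on with
      | _ n ih =>
        intro v hv
        by_cases hvr : v = r
        · rw [hvr]
        · obtain ⟨e, he, hne⟩ := htree v hvr
          have h1 := hz e (Or.inl hne)
          rw [hρtree e hne, one_mul, he] at h1
          rw [h1]
          have h2 := hrank e hne
          rw [he, hv] at h2
          exact ih _ h2 _ rfl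
    have hconst' : ∀ v, z v = z r := fun v => hconst _ v rfl
    have h1 := hz (π f) (Or.inr rfl)
    rw [hconst' (hd _), hconst' (tl _)] at h1
    have h2 : (1 - ρ (π f)) * z r = 0 := by linear_combination h1
    have h3 := (mul_eq_zero.1 h2).resolve_left (sub_ne_zero.2 (hρπ f).symm)
    exact funext fun v => (hconst' v).trans h3
  · have hother : ∀ v, v ≠ f → z v - ρ (π v) * z (tl (π v)) = 0 := by
      intro v hv
      have h1 := hz (π v) (by
        rintro (h | h)
        · exact h (by rw [hπ])
        · exact hv (by rw [← hπ v, h, hπ]))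
      rw [hπ] at h1
      rw [h1, sub_self]
    refine hinj z (funext fun v => ?_)
    rw [hMz]
    by_cases hv : v = f
    · subst hv
      have h1 := hc' z
      rw [Finset.sum_eq_single v (fun w _ hw => by rw [hother w hw, mul_zero])
        (fun h => absurd (Finset.mem_univ v) h), hz₀, sub_self] at h1
      exact (mul_eq_zero.1 h1.symm).resolve_left hf
    · exact hother v hv

/-! ### Rotations as complex numbers, and the rows of the orbit matrix -/

/-- The complex number that acts on the plane as the rotation `γ`. -/
noncomputable def rotationNumber {Γ : Subgroup (Matrix.orthogonalGroup (Fin 2) ℝ)} (γ : Γ) : ℂ :=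
  ⟨orthMat γ 0 0, orthMat γ 1 0⟩

theorem orthMat_inv {d : ℕ} {Γ : Subgroup (Matrix.orthogonalGroup (Fin d) ℝ)} (γ : Γ) :
    orthMat γ⁻¹ = (orthMat γ)ᵀ := rfl

theorem orthMat_eq_of_rotation {Γ : Subgroup (Matrix.orthogonalGroup (Fin 2) ℝ)}
    (hrot : ∀ γ ∈ Γ, (γ : Matrix (Fin 2) (Fin 2) ℝ) ∈ Matrix.specialOrthogonalGroup (Fin 2) ℝ)
    (γ : Γ) :
    orthMat γ = !![(rotationNumber γ).re, -(rotationNumber γ).im;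
      (rotationNumber γ).im, (rotationNumber γ).re] ∧
    (rotationNumber γ).re ^ 2 + (rotationNumber γ).im ^ 2 = 1 := by
  have hdet : (orthMat γ).det = 1 :=
    (Matrix.mem_specialOrthogonalGroup_iff.1 (hrot γ γ.2)).2
  have horth : (orthMat γ)ᵀ * orthMat γ = 1 :=
    Matrix.mem_orthogonalGroup_iff' _ _ |>.1 (γ : Matrix.orthogonalGroup (Fin 2) ℝ).2
  have h00 := congrFun (congrFun horth 0) 0
  have h01 := congrFun (congrFun horth 0) 1
  have h11 := congrFun (congrFun horth 1) 1
  rw [Matrix.det_fin_two] at hdet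
  simp [Matrix.mul_apply, Fin.sum_univ_two] at h00 h01 h11
  simp only [rotationNumber]
  generalize orthMat γ = A at *
  constructor
  · ext i j
    fin_cases i <;> fin_cases j <;> simp
    · linear_combination (-A 0 1) * h00 + A 0 0 * h01 - A 1 0 * hdet
    · linear_combination (-A 1 1) * h00 + A 1 0 * h01 + A 0 0 * hdet
  · linear_combination h00

theorem orbitRigidityMatrix_of_not_inc {α β : Type*} {G : Graph α β} {d : ℕ}
    {Γ : Subgroup (Matrix.orthogonalGroup (Fin d) ℝ)} (φ : G.GainMap Γ)
    (p : V(G) → Fin d → ℝ) {e : E(G)} {v : V(G)} (h : ∀ w : V(G), ¬ G.IsLink e v w)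
    (j : Fin d) : orbitRigidityMatrix φ p e (v, j) = 0 := by
  unfold orbitRigidityMatrix
  rw [dif_neg]
  rintro ⟨w, hw⟩
  exact h w hw

theorem orbitRigidityMatrix_mulVec_of_ne {α β : Type*} {G : Graph α β} [Fintype V(G)] {d : ℕ}
    {Γ : Subgroup (Matrix.orthogonalGroup (Fin d) ℝ)} (φ : G.GainMap Γ)
    (p u : V(G) → Fin d → ℝ) {e : E(G)} {v w : V(G)} (h : G.IsLink e v w) (hvw : v ≠ w) :
    (orbitRigidityMatrix φ p *ᵥ fun vj : V(G) × Fin d => u vj.1 vj.2) e =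
      (p v - orthMat (φ.gain h) *ᵥ p w) ⬝ᵥ u v +
      (p w - orthMat (φ.gain h)⁻¹ *ᵥ p v) ⬝ᵥ u w := by
  classical
  have hg : (φ.gain h)⁻¹ = φ.gain h.symm := by
    rw [φ.gain_symm h (fun h => hvw (Subtype.ext h)), inv_inv]
  simp only [Matrix.mulVec, dotProduct, Fintype.sum_prod_type]
  rw [Finset.sum_eq_add v w hvw]
  · refine congrArg₂ (· + ·) (Finset.sum_congr rfl fun j _ => ?_)
      (Finset.sum_congr rfl fun j _ => ?_)
    · rw [orbitRigidityMatrix_of_ne φ p h hvw]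
    · rw [orbitRigidityMatrix_of_ne φ p h.symm hvw.symm, hg]
  · rintro x - ⟨hxv, hxw⟩
    refine Finset.sum_eq_zero fun j _ => ?_
    rw [orbitRigidityMatrix_of_not_inc φ p (fun y hy => ?_), zero_mul]
    rcases hy.left_eq_or_eq h with h1 | h1
    · exact hxv (Subtype.ext h1)
    · exact hxw (Subtype.ext h1)
  · exact fun h => absurd (Finset.mem_univ _) h
  · exact fun h => absurd (Finset.mem_univ _) h

theorem orbitRigidityMatrix_mulVec_of_loop {α β : Type*} {G : Graph α β} [Fintype V(G)] {d : ℕ}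
    {Γ : Subgroup (Matrix.orthogonalGroup (Fin d) ℝ)} (φ : G.GainMap Γ)
    (p u : V(G) → Fin d → ℝ) {e : E(G)} {v : V(G)} (h : G.IsLink e v v) :
    (orbitRigidityMatrix φ p *ᵥ fun vj : V(G) × Fin d => u vj.1 vj.2) e =
      ((2 : ℝ) • p v - orthMat (φ.gain h) *ᵥ p v - orthMat (φ.gain h)⁻¹ *ᵥ p v) ⬝ᵥ u v := by
  classical
  simp only [Matrix.mulVec, dotProduct, Fintype.sum_prod_type]
  rw [Finset.sum_eq_single v]
  · refine Finset.sum_congr rfl fun j _ => ?_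
    rw [orbitRigidityMatrix_of_loop φ p h]
  · rintro x - hxv
    refine Finset.sum_eq_zero fun j _ => ?_
    rw [orbitRigidityMatrix_of_not_inc φ p (fun y hy => ?_), zero_mul]
    rcases hy.left_eq_or_eq h with h1 | h1 <;> exact hxv (Subtype.ext h1)
  · exact fun h => absurd (Finset.mem_univ _) h

/-- For rotations of the plane, the condition imposed by an edge on a flex says that
`u v - γ u w` is perpendicular to `p v - γ p w`. -/
theorem orbitRigidityMatrix_mulVec_eq_re {α β : Type*} {G : Graph α β} [Fintype V(G)]
    {Γ : Subgroup (Matrix.orthogonalGroup (Fin 2) ℝ)}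
    (hrot : ∀ γ ∈ Γ, (γ : Matrix (Fin 2) (Fin 2) ℝ) ∈ Matrix.specialOrthogonalGroup (Fin 2) ℝ)
    (φ : G.GainMap Γ) (p u : V(G) → Fin 2 → ℝ) {e : E(G)} {v w : V(G)} (h : G.IsLink e v w) :
    (orbitRigidityMatrix φ p *ᵥ fun vj : V(G) × Fin 2 => u vj.1 vj.2) e =
      ((starRingEnd ℂ) (⟨p v 0, p v 1⟩ - rotationNumber (φ.gain h) * ⟨p w 0, p w 1⟩) *
        (⟨u v 0, u v 1⟩ - rotationNumber (φ.gain h) * ⟨u w 0, u w 1⟩)).re := by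
  -- The modulus-one identity `hn` turns the term `|ρ|² p w` of the complex product into the `p w`
  -- of the matrix row.
  obtain ⟨hA, hn⟩ := orthMat_eq_of_rotation hrot (φ.gain h)
  by_cases hvw : v = w
  · subst hvw
    rw [orbitRigidityMatrix_mulVec_of_loop φ p u h, orthMat_inv, hA]
    generalize rotationNumber (φ.gain h) = z at *
    simp [dotProduct, Fin.sum_univ_two, Matrix.vecHead, Matrix.vecTail]
    linear_combination (-(p v 0 * u v 0) - p v 1 * u v 1) * hn
  · rw [orbitRigidityMatrix_mulVec_of_ne φ p u h hvw, orthMat_inv, hA]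
    generalize rotationNumber (φ.gain h) = z at *
    simp [dotProduct, Fin.sum_univ_two]
    linear_combination (-(p w 0 * u w 0) - p w 1 * u w 1) * hn

theorem rotationNumber_injective {Γ : Subgroup (Matrix.orthogonalGroup (Fin 2) ℝ)}
    (hrot : ∀ γ ∈ Γ, (γ : Matrix (Fin 2) (Fin 2) ℝ) ∈ Matrix.specialOrthogonalGroup (Fin 2) ℝ) :
    Function.Injective (rotationNumber (Γ := Γ)) := by
  intro γ δ h
  apply Subtype.ext
  apply Subtype.ext
  change orthMat γ = orthMat δ
  rw [(orthMat_eq_of_rotation hrot γ).1, (orthMat_eq_of_rotation hrot δ).1, h]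

theorem rotationNumber_one {Γ : Subgroup (Matrix.orthogonalGroup (Fin 2) ℝ)} :
    rotationNumber (1 : Γ) = 1 := by
  apply Complex.ext <;> simp [rotationNumber, orthMat]

theorem rotationNumber_mul_inv {Γ : Subgroup (Matrix.orthogonalGroup (Fin 2) ℝ)}
    (hrot : ∀ γ ∈ Γ, (γ : Matrix (Fin 2) (Fin 2) ℝ) ∈ Matrix.specialOrthogonalGroup (Fin 2) ℝ)
    (γ : Γ) : rotationNumber γ * rotationNumber γ⁻¹ = 1 := by
  obtain ⟨hA, hn⟩ := orthMat_eq_of_rotation hrot γ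
  have : rotationNumber γ⁻¹ = (starRingEnd ℂ) (rotationNumber γ) := by
    conv_lhs => rw [rotationNumber, orthMat_inv, hA]
    apply Complex.ext <;> simp
  rw [this, Complex.mul_conj, Complex.normSq_apply, ← pow_two, ← pow_two, hn, Complex.ofReal_one]

/-! ### Gain maps and the conclusion -/

theorem exists_notMem_of_card_lt {Γ : Type*} {n : ℕ} (h : (n : ℕ∞) ≤ ENat.card Γ) (s : Finset Γ)
    (hs : s.card < n) : ∃ x, x ∉ s := by
  by_contra! hall
  have h1 : ENat.card Γ ≤ s.card := by
    rw [← Set.encard_univ, ← Set.encard_coe_eq_coe_finsetCard]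
    exact Set.encard_le_encard fun x _ => hall x
  have := h.trans h1
  exact absurd (by exact_mod_cast this) (not_le.2 hs)

/-- The gain map with the gain `g e` on each edge `e`, oriented from `hd e` to `tl e`. -/
theorem Graph.exists_gainMap {α β Γ : Type*} [Group Γ] {G : Graph α β} (hd tl : E(G) → V(G))
    (hlink : ∀ e : E(G), G.IsLink e (hd e) (tl e)) (g : E(G) → Γ)
    (hloop : ∀ e, hd e = tl e → g e ≠ 1)
    (hsame : ∀ e e', e ≠ e' → hd e = hd e' → tl e = tl e' → g e ≠ g e')
    (hrev : ∀ e e', e ≠ e' → hd e = tl e' → tl e = hd e' → g e ≠ (g e')⁻¹) :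
    ∃ φ : G.GainMap Γ, ∀ e, φ.gain (hlink e) = g e := by
  classical
  have hcases : ∀ {e : β} {v w : α} (h : G.IsLink e v w),
      (v = hd ⟨e, h.edge_mem⟩ ∧ w = tl ⟨e, h.edge_mem⟩) ∨
      (v ≠ hd ⟨e, h.edge_mem⟩ ∧ v = tl ⟨e, h.edge_mem⟩ ∧ w = hd ⟨e, h.edge_mem⟩) := by
    intro e v w h
    have hl := hlink ⟨e, h.edge_mem⟩
    by_cases hv : v = hd ⟨e, h.edge_mem⟩
    · exact Or.inl ⟨hv, (h.eq_and_eq_or_eq_and_eq hl).elim (·.2) fun h' =>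
        h'.2.trans (hv.symm.trans h'.1)⟩
    · exact (h.eq_and_eq_or_eq_and_eq hl).elim (fun h => absurd h.1 hv) fun h => Or.inr ⟨hv, h⟩
  let gain : ∀ {e : β} {v w : α}, G.IsLink e v w → Γ := fun {e v w} h =>
    if v = hd ⟨e, h.edge_mem⟩ then g ⟨e, h.edge_mem⟩ else (g ⟨e, h.edge_mem⟩)⁻¹
  refine ⟨⟨gain, ?_, ?_, ?_⟩, fun e => if_pos rfl⟩
  · intro e v w h hvw
    simp only [gain]
    rcases hcases h with ⟨h1, h2⟩ | ⟨h1, h2, h3⟩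
    · rw [if_pos h1, if_neg (fun h3 => hvw (h1.trans h3.symm)), inv_inv]
    · rw [if_neg h1, if_pos h3]
  · intro e e' v w h h' hee
    have hee' : (⟨e, h.edge_mem⟩ : E(G)) ≠ ⟨e', h'.edge_mem⟩ := fun h =>
      hee (congrArg Subtype.val h)
    simp only [gain]
    rcases hcases h with ⟨h1, h2⟩ | ⟨h1, h2, h3⟩ <;> rcases hcases h' with ⟨k1, k2⟩ | ⟨k1, k2, k3⟩
    · rw [if_pos h1, if_pos k1]
      exact hsame _ _ hee' (Subtype.ext (h1.symm.trans k1)) (Subtype.ext (h2.symm.trans k2))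
    · rw [if_pos h1, if_neg k1]
      exact hrev _ _ hee' (Subtype.ext (h1.symm.trans k2)) (Subtype.ext (h2.symm.trans k3))
    · rw [if_neg h1, if_pos k1]
      exact (hrev _ _ hee'.symm (Subtype.ext (k1.symm.trans h2))
        (Subtype.ext (k2.symm.trans h3))).symm
    · rw [if_neg h1, if_neg k1]
      exact inv_injective.ne
        (hsame _ _ hee' (Subtype.ext (h3.symm.trans k3)) (Subtype.ext (h2.symm.trans k2)))
  · intro e v h
    simp only [gain]
    rcases hcases h with ⟨h1, h2⟩ | ⟨h1, h2, h3⟩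
    · rw [if_pos h1]
      exact hloop _ (Subtype.ext (h1.symm.trans h2))
    · exact absurd h3 h1

theorem mainTheorem1 {α β : Type*} (G : Graph α β) [Fintype V(G)] [Finite E(G)]
    (hG : G.IsTight 2 1)
    (Γ : Subgroup (Matrix.orthogonalGroup (Fin 2) ℝ))
    (hrot : ∀ γ ∈ Γ, (γ : Matrix (Fin 2) (Fin 2) ℝ) ∈ Matrix.specialOrthogonalGroup (Fin 2) ℝ)
    (hcard : 3 ≤ ENat.card Γ) :
    ∃ φ : G.GainMap Γ, IsSymRigid φ := by
  classical
  have := Fintype.ofFinite E(G)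
  obtain ⟨hd, tl, π, rank, r, hlink, hπ, hrank, htree, huniq⟩ := hG.exists_orientation
  have hEcard : Fintype.card E(G) + 1 = 2 * Fintype.card V(G) := by
    rw [← Nat.card_eq_fintype_card, ← Nat.card_eq_fintype_card]
    exact hG.2
  obtain ⟨a, ha⟩ := exists_notMem_of_card_lt hcard {1} (by simp)
  obtain ⟨b, hb⟩ := exists_notMem_of_card_lt hcard {1, a}
    ((Finset.card_le_two).trans_lt (by norm_num))
  simp only [Finset.mem_singleton, Finset.mem_insert, not_or] at ha hb
  have hinj := rotationNumber_injective hrot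
  obtain ⟨c, hc, hdet⟩ := exists_weights_det_ne_zero (fun v => tl (π v)) rotationNumber
    (hinj.ne (Ne.symm hb.2))
  have hc1 : ∀ v, c v ≠ 1 := fun v => by
    rcases hc v with h | h <;> rw [h]
    exacts [ha, hb.1]
  -- For antiparallel `π v`, `π w` with inverse gains, row `v` plus `ρ(c v)` times row `w` is zero,
  -- contradicting `hdet`.
  have htwo : ∀ v w, v ≠ w → tl (π v) = w → tl (π w) = v → c v ≠ (c w)⁻¹ := by
    intro v w hvw hv hw h
    refine hdet (Matrix.exists_vecMul_eq_zero_iff.1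
      ⟨Pi.single v 1 + rotationNumber (c v) • Pi.single w 1, fun h0 => ?_, ?_⟩)
    · have := congrFun h0 v
      simp [hvw] at this
    · have h1 : rotationNumber (c v) * rotationNumber (c w) = 1 := by
        rw [h, mul_comm]; exact rotationNumber_mul_inv hrot (c w)
      rw [Matrix.add_vecMul, Matrix.smul_vecMul, Matrix.single_one_vecMul,
        Matrix.single_one_vecMul]
      funext x
      simp only [Matrix.row, Matrix.of_apply, Pi.add_apply, Pi.sub_apply, Pi.smul_apply,
        smul_eq_mul, Pi.zero_apply, hv, hw]
      linear_combination -(Pi.single v 1 : V(G) → ℂ) x * h1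
  let g : E(G) → Γ := fun e => if e = π (hd e) then c (hd e) else 1
  have hgπ : ∀ e, e = π (hd e) → g e = c (hd e) := fun e he => if_pos he
  have hgt : ∀ e, e ≠ π (hd e) → g e = 1 := fun e he => if_neg he
  obtain ⟨φ, hφ⟩ := Graph.exists_gainMap hd tl hlink g
    (fun e he => by
      by_cases h : e = π (hd e)
      · rw [hgπ e h]; exact hc1 _
      · have := hrank e h
        rw [he] at this
        exact absurd this (lt_irrefl _))
    (fun e e' hne hh ht => by
      by_cases h : e = π (hd e) <;> by_cases h' : e' = π (hd e')
      · exact absurd (by rw [h, h', hh]) hne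
      · rw [hgπ e h, hgt e' h']; exact hc1 _
      · rw [hgt e h, hgπ e' h']; exact (hc1 _).symm
      · exact absurd (huniq e e' h h' hh) hne)
    (fun e e' hne hh ht => by
      by_cases h : e = π (hd e) <;> by_cases h' : e' = π (hd e')
      · rw [hgπ e h, hgπ e' h']
        refine htwo _ _ (fun hvw => hne (by rw [h, h', hvw])) ?_ ?_
        · rw [← h, ht]
        · rw [← h', hh]
      · rw [hgπ e h, hgt e' h', inv_one]; exact hc1 _
      · rw [hgt e h, hgπ e' h']; exact (inv_ne_one.2 (hc1 _)).symm
      · have h1 := hrank e h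
        have h2 := hrank e' h'
        rw [hh, ht] at h1
        omega)
  have hρπ : ∀ v, g (π v) = c v := fun v => by rw [hgπ _ (by rw [hπ]), hπ]
  have : Nonempty E(G) := ⟨π r⟩
  obtain ⟨p, hp⟩ := exists_rigid_placement hEcard hd tl (fun e => rotationNumber (g e))
    (exists_two_bases hd tl π rank r hπ hrank htree (fun e => rotationNumber (g e))
      (fun e he => by rw [hgt e he, rotationNumber_one])
      (fun v => by rw [hρπ, ← rotationNumber_one (Γ := Γ)]; exact hinj.ne (hc1 v))
      (by simpa only [hρπ] using hdet))
  refine ⟨φ, fun v => ![(p v).re, (p v).im], fun u hu => ?_⟩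
  obtain ⟨s, hs⟩ := hp (fun v => ⟨u v 0, u v 1⟩) fun e => by
    have h1 := congrFun hu e
    rw [orbitRigidityMatrix_mulVec_eq_re hrot φ _ u (hlink e), hφ] at h1
    exact h1
  -- The matrix of multiplication by `s * I`, which commutes with rotations, so no translation is
  -- needed.
  refine ⟨!![0, -s; s, 0], 0, ?_, fun y => ?_⟩
  · ext i j
    fin_cases i <;> fin_cases j <;> simp
  · have h0 : u y.1 0 = -s * (p y.1).im := by simpa using congrArg Complex.re (hs y.1)
    have h1 : u y.1 1 = s * (p y.1).re := by simpa using congrArg Complex.im (hs y.1)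
    simp only [symLift, (orthMat_eq_of_rotation hrot y.2).1]
    funext i
    fin_cases i <;> simp [Matrix.mulVec, dotProduct, Fin.sum_univ_two, h0, h1] <;> ring
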